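/- Let $\alpha,\theta\in\mathbb R$ with $\theta/2\pi$ irrational, and let $f:\mathbb T\to\mathbb T$ be a continuous map of the unit circle $\mathbb T=\{z\in\mathbb C: |z|=1\}$. Let $\mathbb A_\alpha$ be the noncommutative $2$-torus, that is, the universal unital $C^*$-algebra generated by two unitaries $U,V$ subject to $UV=e^{2\pi i\alpha}VU$. Let $\tau$ be its canonical trace, that is, the state with $\tau(U^mV^n)=\delta_{m,0}\,\delta_{n,0}$ for $m,n\in\mathbb Z$. Let $\Phi_{\theta,f}$ be the Anzai skew-product, that is, the unital $*$-homomorphism $\mathbb A_\alpha\to\mathbb A_\alpha$ (in fact a $*$-automorphism) determined by $\Phi_{\theta,f}(U)=e^{i\theta}U$ and $\Phi_{\theta,f}(V)=f(U)V$, where $f(U)$ is given by the continuous functional calculus. Suppose that $(\mathbb A_\alpha,\Phi_{\theta,f},\tau)$ is ergodic, that is, $\tau$ is an extreme point of the convex set of $\Phi_{\theta,f}$-invariant states of $\mathbb A_\alpha$. Then $(\mathbb A_\alpha,\Phi_{\theta,f})$ is minimal: $\mathbb A_\alpha$ itself is the unique nonzero hereditary $C^*$-subalgebra $B\subseteq\mathbb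 A_\alpha$ with $\Phi_{\theta,f}(B)\subseteq B$. (A $C^*$-subalgebra $B$, i.e. a norm-closed $*$-subalgebra that need not contain the unit, is hereditary if $0\le a\le b$ with $b\in B$ and $a\in\mathbb A_\alpha$ implies $a\in B$.) -/

import Mathlib

open scoped ComplexOrder

noncomputable section

/-! ### The noncommutative torus as a universal C⋆-algebra -/

/-- The free unital `*`-algebra on two unitary indeterminates: the complex group algebra of the
free group on two generators, with involution `(c g)* = c̄ g⁻¹`.  The parameter `α` is the
deformation parameter, which enters through the norm below. -/
def PreNCTorus (_α : ℝ) : Type := MonoidAlgebra ℂ (FreeGroup (Fin 2))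

namespace PreNCTorus

variable {α : ℝ}

instance instRing : Ring (PreNCTorus α) :=
  inferInstanceAs (Ring (MonoidAlgebra ℂ (FreeGroup (Fin 2))))

instance instAlgebra : Algebra ℂ (PreNCTorus α) :=
  inferInstanceAs (Algebra ℂ (MonoidAlgebra ℂ (FreeGroup (Fin 2))))

/-- The monomial `c g`. -/
def mono (g : FreeGroup (Fin 2)) (c : ℂ) : PreNCTorus α := MonoidAlgebra.single g c

theorem mono_mul (g h : FreeGroup (Fin 2)) (c d : ℂ) :
    (mono g c * mono h d : PreNCTorus α) = mono (g * h) (c * d) :=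
  MonoidAlgebra.single_mul_single ..

theorem mono_one : (mono 1 1 : PreNCTorus α) = 1 := rfl

theorem smul_mono (g : FreeGroup (Fin 2)) (c d : ℂ) :
    (c • mono g d : PreNCTorus α) = mono g (c * d) :=
  MonoidAlgebra.smul_single ..

theorem induct {motive : PreNCTorus α → Prop} (x : PreNCTorus α)
    (h0 : motive 0) (hadd : ∀ x y, motive x → motive y → motive (x + y))
    (hs : ∀ g c, motive (mono g c)) : motive x :=
  MonoidAlgebra.induction_linear (motive := motive) x h0 hadd hs

/-- The involution, as an additive map. -/
def starHom : PreNCTorus α →+ PreNCTorus α where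
  toFun x := MonoidAlgebra.mapDomain (fun g => g⁻¹)
    (MonoidAlgebra.map (starRingEnd ℂ : ℂ →+ ℂ) x)
  map_zero' := by
    exact (congrArg _ (MonoidAlgebra.map_zero _)).trans (MonoidAlgebra.mapDomain_zero _)
  map_add' x y := by
    exact (congrArg _ (MonoidAlgebra.map_add _ _ _)).trans (MonoidAlgebra.mapDomain_add _ _ _)

theorem starHom_mono (g : FreeGroup (Fin 2)) (c : ℂ) :
    starHom (mono g c : PreNCTorus α) = mono g⁻¹ (star c) :=
  (congrArg _ (MonoidAlgebra.map_single _ _ _)).trans MonoidAlgebra.mapDomain_single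

theorem starHom_starHom (x : PreNCTorus α) : starHom (starHom x) = x := by
  induction x using induct with
  | h0 => simp
  | hadd x y hx hy => rw [map_add, map_add, hx, hy]
  | hs g c => rw [starHom_mono, starHom_mono, inv_inv, star_star]

theorem starHom_mul (x y : PreNCTorus α) : starHom (x * y) = starHom y * starHom x := by
  induction x using induct with
  | h0 => simp
  | hadd x x' hx hx' => rw [add_mul, map_add, map_add, mul_add, hx, hx']
  | hs g c =>
    induction y using induct with
    | h0 => simp
    | hadd y y' hy hy' => rw [mul_add, map_add, map_add, add_mul, hy, hy']
    | hs h d =>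
      rw [mono_mul, starHom_mono, starHom_mono, starHom_mono, mono_mul, mul_inv_rev, star_mul]

instance instStarRing : StarRing (PreNCTorus α) where
  star := starHom
  star_involutive := starHom_starHom
  star_mul := starHom_mul
  star_add := map_add starHom

theorem star_mono (g : FreeGroup (Fin 2)) (c : ℂ) :
    star (mono g c : PreNCTorus α) = mono g⁻¹ (star c) := starHom_mono g c

instance instStarModule : StarModule ℂ (PreNCTorus α) where
  star_smul c x := by
    induction x using induct with
    | h0 => simp
    | hadd x y hx hy => rw [smul_add, star_add, star_add, smul_add, hx, hy]
    | hs g d => rw [smul_mono, star_mono, star_mono, smul_mono, star_mul, mul_comm]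

/-- The first unitary indeterminate. -/
def genU : PreNCTorus α := mono (FreeGroup.of 0) 1

/-- The second unitary indeterminate. -/
def genV : PreNCTorus α := mono (FreeGroup.of 1) 1

variable (α) in
/-- The C⋆-seminorms on the free `*`-algebra on two unitaries for which the relation
`U V = e^{2πiα} V U` holds. -/
structure CStarSeminorm extends Seminorm ℂ (PreNCTorus α) where
  mul_le' : ∀ x y, toFun (x * y) ≤ toFun x * toFun y
  cstar' : ∀ x, toFun (star x * x) = toFun x * toFun x
  rel' : toFun (genU * genV - Complex.exp (2 * Real.pi * Complex.I * α) • (genV * genU)) = 0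

namespace CStarSeminorm

instance : Inhabited (CStarSeminorm α) where
  default :=
    { (0 : Seminorm ℂ (PreNCTorus α)) with
      mul_le' := fun x y => by
        change (0 : ℝ) ≤ 0 * 0
        simp
      cstar' := fun x => by
        change (0 : ℝ) = 0 * 0
        simp
      rel' := rfl }

variable (p : CStarSeminorm α)

theorem mul_le (x y : PreNCTorus α) :
    p.toSeminorm (x * y) ≤ p.toSeminorm x * p.toSeminorm y := p.mul_le' x y

theorem cstar (x : PreNCTorus α) :
    p.toSeminorm (star x * x) = p.toSeminorm x * p.toSeminorm x := p.cstar' x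

theorem le_one_of_idem {r : ℝ} (h : r = r * r) : r ≤ 1 := by nlinarith [sq_nonneg (r - 1)]

theorem mono_le (g : FreeGroup (Fin 2)) (c : ℂ) : p.toSeminorm (mono g c) ≤ ‖c‖ := by
  have h1 : p.toSeminorm (1 : PreNCTorus α) ≤ 1 := by
    refine le_one_of_idem ?_
    have := p.cstar 1
    rwa [star_one, mul_one] at this
  have h2 : p.toSeminorm (mono g 1) ≤ 1 := by
    have := p.cstar (mono g 1)
    rw [star_mono, mono_mul, inv_mul_cancel, star_one, mul_one, mono_one] at this
    nlinarith [apply_nonneg p.toSeminorm (mono g 1)]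
  have h3 : (mono g c : PreNCTorus α) = c • mono g 1 := by rw [smul_mono, mul_one]
  rw [h3, map_smul_eq_mul]
  exact mul_le_of_le_one_right (norm_nonneg c) h2

theorem star_eq (x : PreNCTorus α) : p.toSeminorm (star x) = p.toSeminorm x := by
  have key : ∀ y, p.toSeminorm y ≤ p.toSeminorm (star y) := by
    intro y
    by_contra! h
    have h1 := p.cstar y
    have h2 := p.mul_le (star y) y
    nlinarith [apply_nonneg p.toSeminorm (star y), apply_nonneg p.toSeminorm y]
  refine le_antisymm ?_ (key x)
  simpa using key (star x)

theorem bdd (x : PreNCTorus α) :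
    BddAbove (Set.range fun p : CStarSeminorm α => p.toSeminorm x) := by
  induction x using induct with
  | h0 => exact ⟨0, by rintro _ ⟨p, rfl⟩; simp⟩
  | hadd x y hx hy =>
    obtain ⟨a, ha⟩ := hx
    obtain ⟨b, hb⟩ := hy
    refine ⟨a + b, ?_⟩
    rintro _ ⟨p, rfl⟩
    exact (map_add_le_add _ _ _).trans (add_le_add (ha ⟨p, rfl⟩) (hb ⟨p, rfl⟩))
  | hs g c => exact ⟨‖c‖, by rintro _ ⟨p, rfl⟩; exact p.mono_le g c⟩

end CStarSeminorm

/-- The largest C⋆-seminorm for which `U V = e^{2πiα} V U`. -/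
def univNorm (x : PreNCTorus α) : ℝ := ⨆ p : CStarSeminorm α, p.toSeminorm x

theorem le_univNorm (p : CStarSeminorm α) (x : PreNCTorus α) : p.toSeminorm x ≤ univNorm x :=
  le_ciSup (CStarSeminorm.bdd x) p

theorem univNorm_le {x : PreNCTorus α} {r : ℝ}
    (h : ∀ p : CStarSeminorm α, p.toSeminorm x ≤ r) : univNorm x ≤ r := ciSup_le h

theorem univNorm_nonneg (x : PreNCTorus α) : 0 ≤ univNorm x :=
  (apply_nonneg _ x).trans (le_univNorm default x)

theorem univNorm_add (x y : PreNCTorus α) : univNorm (x + y) ≤ univNorm x + univNorm y :=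
  univNorm_le fun p =>
    (map_add_le_add _ _ _).trans (add_le_add (le_univNorm p x) (le_univNorm p y))

theorem univNorm_smul (c : ℂ) (x : PreNCTorus α) : univNorm (c • x) = ‖c‖ * univNorm x := by
  simp only [univNorm, map_smul_eq_mul]
  exact (Real.mul_iSup_of_nonneg (norm_nonneg c) _).symm

theorem univNorm_mul (x y : PreNCTorus α) : univNorm (x * y) ≤ univNorm x * univNorm y :=
  univNorm_le fun p => (p.mul_le x y).trans <|
    mul_le_mul (le_univNorm p x) (le_univNorm p y) (apply_nonneg _ _) (univNorm_nonneg x)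

theorem univNorm_star (x : PreNCTorus α) : univNorm (star x) = univNorm x := by
  simp only [univNorm, CStarSeminorm.star_eq]

theorem univNorm_cstar (x : PreNCTorus α) :
    univNorm x * univNorm x ≤ univNorm (star x * x) := by
  have h : univNorm x ≤ Real.sqrt (univNorm (star x * x)) :=
    univNorm_le fun p => Real.le_sqrt_of_sq_le <| by
      rw [sq, ← p.cstar]
      exact le_univNorm p _
  calc univNorm x * univNorm x
      ≤ Real.sqrt (univNorm (star x * x)) * Real.sqrt (univNorm (star x * x)) :=
        mul_self_le_mul_self (univNorm_nonneg x) h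
    _ = _ := Real.mul_self_sqrt (univNorm_nonneg _)

instance instNorm : Norm (PreNCTorus α) := ⟨univNorm⟩

instance instSeminormedAddCommGroup : SeminormedAddCommGroup (PreNCTorus α) :=
  SeminormedAddCommGroup.ofCore (𝕜 := ℂ)
    { norm_nonneg := univNorm_nonneg
      norm_smul := univNorm_smul
      norm_triangle := univNorm_add }

instance instSeminormedRing : SeminormedRing (PreNCTorus α) :=
  { instSeminormedAddCommGroup, instRing with
    norm_mul_le := univNorm_mul }

instance instNormedAlgebra : NormedAlgebra ℂ (PreNCTorus α) :=
  { instAlgebra with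
    norm_smul_le := fun c x => (univNorm_smul c x).le }

theorem norm_def (x : PreNCTorus α) : ‖x‖ = univNorm x := rfl

instance instNormedStarGroup : NormedStarGroup (PreNCTorus α) :=
  ⟨fun x => (univNorm_star x).le⟩

end PreNCTorus

/-- The noncommutative torus `𝔸_α`: the Hausdorff completion of the free `*`-algebra on two
unitary indeterminates in the largest C⋆-seminorm for which `U V = e^{2πiα} V U`. -/
def NCTorus (α : ℝ) : Type := UniformSpace.Completion (PreNCTorus α)

namespace NCTorus

open UniformSpace

variable {α : ℝ}

instance instNormedRing : NormedRing (NCTorus α) :=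
  inferInstanceAs (NormedRing (Completion (PreNCTorus α)))

instance instCompleteSpace : CompleteSpace (NCTorus α) :=
  inferInstanceAs (CompleteSpace (Completion (PreNCTorus α)))

instance instNormedAlgebra : NormedAlgebra ℂ (NCTorus α) :=
  { (inferInstanceAs (Algebra ℂ (Completion (PreNCTorus α))) : Algebra ℂ (NCTorus α)) with
    norm_smul_le := fun c x =>
      (norm_smul_le c (show Completion (PreNCTorus α) from x) :) }

/-- The canonical map from the free `*`-algebra. -/
def of (x : PreNCTorus α) : NCTorus α := (x : Completion (PreNCTorus α))

theorem continuous_of : Continuous (of : PreNCTorus α → NCTorus α) :=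
  Completion.continuous_coe _

theorem norm_of (x : PreNCTorus α) : ‖of x‖ = ‖x‖ := Completion.norm_coe x
theorem of_add (x y : PreNCTorus α) : of (x + y) = of x + of y := Completion.coe_add x y
theorem of_mul (x y : PreNCTorus α) : of (x * y) = of x * of y := Completion.coe_mul x y
theorem of_one : of (1 : PreNCTorus α) = 1 := Completion.coe_one _
theorem of_zero : of (0 : PreNCTorus α) = 0 := Completion.coe_zero
theorem of_sub (x y : PreNCTorus α) : of (x - y) = of x - of y := Completion.coe_sub x y
theorem of_smul (c : ℂ) (x : PreNCTorus α) : of (c • x) = c • of x := Completion.coe_smul c x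

theorem denseRange_of : DenseRange (of : PreNCTorus α → NCTorus α) := Completion.denseRange_coe

theorem induct {motive : NCTorus α → Prop} (x : NCTorus α)
    (hc : IsClosed {x | motive x}) (h : ∀ x, motive (of x)) : motive x :=
  Completion.induction_on x hc h

theorem induct₂ {motive : NCTorus α → NCTorus α → Prop} (x y : NCTorus α)
    (hc : IsClosed {z : NCTorus α × NCTorus α | motive z.1 z.2})
    (h : ∀ x y, motive (of x) (of y)) : motive x y :=
  Completion.induction_on₂ x y hc h

/-- The involution, extended by continuity. -/
def starMap : NCTorus α → NCTorus α :=
  Completion.map (star : PreNCTorus α → PreNCTorus α)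

theorem continuous_starMap : Continuous (starMap : NCTorus α → NCTorus α) :=
  Completion.continuous_map

theorem starMap_of (x : PreNCTorus α) : starMap (of x) = of (star x) :=
  Completion.map_coe (starₗᵢ ℂ (E := PreNCTorus α)).isometry.uniformContinuous x

instance instStarRing : StarRing (NCTorus α) where
  star := starMap
  star_involutive x := by
    refine induct (motive := fun x => starMap (starMap x) = x) x
      (isClosed_eq (continuous_starMap.comp continuous_starMap) continuous_id) ?_
    intro x
    rw [starMap_of, starMap_of, star_star]
  star_mul x y := by
    refine induct₂ (motive := fun x y => starMap (x * y) = starMap y * starMap x) x y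
      (isClosed_eq (continuous_starMap.comp continuous_mul)
      ((continuous_starMap.comp continuous_snd).mul
        (continuous_starMap.comp continuous_fst))) ?_
    intro x y
    rw [← of_mul, starMap_of, starMap_of, starMap_of, star_mul, of_mul]
  star_add x y := by
    refine induct₂ (motive := fun x y => starMap (x + y) = starMap x + starMap y) x y
      (isClosed_eq (continuous_starMap.comp continuous_add)
      ((continuous_starMap.comp continuous_fst).add
        (continuous_starMap.comp continuous_snd))) ?_
    intro x y
    rw [← of_add, starMap_of, starMap_of, starMap_of, star_add, of_add]

theorem star_of (x : PreNCTorus α) : star (of x) = of (star x) := starMap_of x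

theorem continuous_star' : Continuous (star : NCTorus α → NCTorus α) := continuous_starMap

instance instStarModule : StarModule ℂ (NCTorus α) where
  star_smul c x := by
    refine induct (motive := fun x => star (c • x) = star c • star x) x
      (isClosed_eq (continuous_star'.comp (continuous_const_smul c))
      (continuous_star'.const_smul (star c))) ?_
    intro x
    rw [← of_smul, star_of, star_of, star_smul, of_smul]

instance instCStarRing : CStarRing (NCTorus α) where
  norm_mul_self_le x := by
    refine induct (motive := fun x => ‖x‖ * ‖x‖ ≤ ‖star x * x‖) x
      (isClosed_le (continuous_norm.mul continuous_norm)
      (continuous_norm.comp (continuous_star'.mul continuous_id))) ?_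
    intro x
    rw [star_of, ← of_mul, norm_of, norm_of]
    exact PreNCTorus.univNorm_cstar x

instance instCStarAlgebra : CStarAlgebra (NCTorus α) where

instance instPartialOrder : PartialOrder (NCTorus α) := CStarAlgebra.spectralOrder _

instance instStarOrderedRing : StarOrderedRing (NCTorus α) := CStarAlgebra.spectralOrderedRing _

theorem of_mono_mem_unitary (g : FreeGroup (Fin 2)) :
    of (PreNCTorus.mono g 1) ∈ unitary (NCTorus α) := by
  constructor <;>
  simp [star_of, ← of_mul, PreNCTorus.star_mono, PreNCTorus.mono_mul, PreNCTorus.mono_one, of_one]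

variable (α) in
/-- The unitary generator `U` of `𝔸_α`. -/
def U : unitary (NCTorus α) := ⟨of PreNCTorus.genU, of_mono_mem_unitary _⟩

variable (α) in
/-- The unitary generator `V` of `𝔸_α`. -/
def V : unitary (NCTorus α) := ⟨of PreNCTorus.genV, of_mono_mem_unitary _⟩

/-- The defining commutation relation for a pair of elements. -/
def Rel (α : ℝ) {B : Type*} [Mul B] [SMul ℂ B] (u v : B) : Prop :=
  u * v = Complex.exp (2 * Real.pi * Complex.I * α) • (v * u)

variable (α) in
theorem rel_U_V : Rel α (U α : NCTorus α) (V α) := by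
  unfold Rel U V
  rw [← sub_eq_zero, ← norm_eq_zero, ← of_mul, ← of_mul, ← of_smul, ← of_sub, norm_of]
  refine le_antisymm (PreNCTorus.univNorm_le fun p => ?_) (norm_nonneg _)
  exact p.rel'.le

/-! ### The universal property -/

section Lift

variable {B : Type*} [CStarAlgebra B]

/-- The unital `*`-homomorphism on the free `*`-algebra determined by two unitaries. -/
def preLift (u v : unitary B) : PreNCTorus α →ₐ[ℂ] B :=
  (MonoidAlgebra.lift ℂ B (FreeGroup (Fin 2))
    ((unitary B).subtype.comp (FreeGroup.lift ![u, v])) :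
      MonoidAlgebra ℂ (FreeGroup (Fin 2)) →ₐ[ℂ] B)

theorem preLift_mono (u v : unitary B) (g : FreeGroup (Fin 2)) (c : ℂ) :
    preLift (α := α) u v (PreNCTorus.mono g c) = c • (FreeGroup.lift ![u, v] g : B) :=
  MonoidAlgebra.lift_single _ _ _

theorem preLift_genU (u v : unitary B) : preLift (α := α) u v PreNCTorus.genU = u := by
  simp [PreNCTorus.genU, preLift_mono]

theorem preLift_genV (u v : unitary B) : preLift (α := α) u v PreNCTorus.genV = v := by
  simp [PreNCTorus.genV, preLift_mono]

theorem preLift_star (u v : unitary B) (x : PreNCTorus α) :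
    preLift u v (star x) = star (preLift u v x) := by
  induction x using PreNCTorus.induct with
  | h0 => simp
  | hadd x y hx hy => rw [star_add, map_add, map_add, star_add, hx, hy]
  | hs g c =>
    rw [PreNCTorus.star_mono, preLift_mono, preLift_mono, map_inv, star_smul]
    rfl

/-- The C⋆-seminorm induced by a pair of unitaries satisfying the commutation relation. -/
def inducedSeminorm (u v : unitary B) (h : Rel α (u : B) v) : PreNCTorus.CStarSeminorm α :=
  { (normSeminorm ℂ B).comp (preLift (α := α) u v).toLinearMap with
    mul_le' := fun x y => by
      change ‖preLift u v (x * y)‖ ≤ ‖preLift u v x‖ * ‖preLift u v y‖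
      rw [map_mul]
      exact norm_mul_le _ _
    cstar' := fun x => by
      change ‖preLift u v (star x * x)‖ = ‖preLift u v x‖ * ‖preLift u v x‖
      rw [map_mul, preLift_star]
      exact CStarRing.norm_star_mul_self
    rel' := by
      change ‖preLift u v _‖ = 0
      rw [map_sub, map_smul, map_mul, map_mul, preLift_genU, preLift_genV, norm_eq_zero,
        sub_eq_zero]
      exact h }

theorem norm_preLift_le (u v : unitary B) (h : Rel α (u : B) v) (x : PreNCTorus α) :
    ‖preLift u v x‖ ≤ ‖x‖ :=
  PreNCTorus.le_univNorm (inducedSeminorm u v h) x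

theorem uniformContinuous_preLift (u v : unitary B) (h : Rel α (u : B) v) :
    UniformContinuous (preLift (α := α) u v) :=
  ((preLift (α := α) u v).toLinearMap.mkContinuous 1
    fun x => (norm_preLift_le u v h x).trans (one_mul _).ge).uniformContinuous

/-- The continuous extension of `preLift`, as a map. -/
def liftFun (u v : unitary B) (_h : Rel α (u : B) v) : NCTorus α → B :=
  Completion.extension (preLift (α := α) u v)

theorem liftFun_of (u v : unitary B) (h : Rel α (u : B) v) (x : PreNCTorus α) :
    liftFun u v h (of x) = preLift u v x :=
  Completion.extension_coe (uniformContinuous_preLift u v h) x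

theorem continuous_liftFun (u v : unitary B) (h : Rel α (u : B) v) :
    Continuous (liftFun u v h) := Completion.continuous_extension

/-- The universal property of `𝔸_α`: a pair of unitaries `u, v` of a unital C⋆-algebra with
`u v = e^{2πiα} v u` determines a unital `*`-homomorphism with `U ↦ u` and `V ↦ v`. -/
def lift (u v : unitary B) (h : Rel α (u : B) v) : NCTorus α →⋆ₐ[ℂ] B where
  toFun := liftFun u v h
  map_one' := by rw [← of_one, liftFun_of, map_one]
  map_mul' x y := by
    have hc := continuous_liftFun u v h
    refine induct₂ (motive := fun x y =>
      liftFun u v h (x * y) = liftFun u v h x * liftFun u v h y) x y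
      (isClosed_eq (hc.comp continuous_mul)
      ((hc.comp continuous_fst).mul (hc.comp continuous_snd))) ?_
    intro x y
    rw [← of_mul, liftFun_of, liftFun_of, liftFun_of, map_mul]
  map_zero' := by rw [← of_zero, liftFun_of, map_zero]
  map_add' x y := by
    have hc := continuous_liftFun u v h
    refine induct₂ (motive := fun x y =>
      liftFun u v h (x + y) = liftFun u v h x + liftFun u v h y) x y
      (isClosed_eq (hc.comp continuous_add)
      ((hc.comp continuous_fst).add (hc.comp continuous_snd))) ?_
    intro x y
    rw [← of_add, liftFun_of, liftFun_of, liftFun_of, map_add]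
  commutes' c := by
    rw [Algebra.algebraMap_eq_smul_one, ← of_one, ← of_smul, liftFun_of, map_smul, map_one,
      Algebra.algebraMap_eq_smul_one]
  map_star' x := by
    have hc := continuous_liftFun u v h
    refine induct (motive := fun x => liftFun u v h (star x) = star (liftFun u v h x)) x
      (isClosed_eq (hc.comp continuous_star') hc.star) ?_
    intro x
    rw [star_of, liftFun_of, liftFun_of, preLift_star]

theorem lift_U (u v : unitary B) (h : Rel α (u : B) v) : lift u v h (U α) = u :=
  (liftFun_of u v h _).trans (preLift_genU u v)

theorem lift_V (u v : unitary B) (h : Rel α (u : B) v) : lift u v h (V α) = v :=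
  (liftFun_of u v h _).trans (preLift_genV u v)

/-- Uniqueness in the universal property. -/
theorem hom_ext {φ ψ : NCTorus α →⋆ₐ[ℂ] B} (hU : φ (U α) = ψ (U α)) (hV : φ (V α) = ψ (V α)) :
    φ = ψ := by
  have hg : ∀ g : FreeGroup (Fin 2),
      φ (of (PreNCTorus.mono g 1)) = ψ (of (PreNCTorus.mono g 1)) := by
    intro g
    induction g using FreeGroup.induction_on with
    | C1 => rw [PreNCTorus.mono_one, of_one, map_one, map_one]
    | of i => fin_cases i; exacts [hU, hV]
    | inv_of i hi =>
      rw [← star_one ℂ, ← PreNCTorus.star_mono, ← star_of, map_star, map_star, hi]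
    | mul g h hg hh =>
      rw [← mul_one (1 : ℂ), ← PreNCTorus.mono_mul, of_mul, map_mul, map_mul, hg, hh]
  ext x
  refine induct (motive := fun x => φ x = ψ x) x
    (isClosed_eq
    (AddMonoidHomClass.continuous_of_bound φ 1 fun a => by
      simpa using NonUnitalStarAlgHom.norm_apply_le φ a)
    (AddMonoidHomClass.continuous_of_bound ψ 1 fun a => by
      simpa using NonUnitalStarAlgHom.norm_apply_le ψ a)) ?_
  intro x
  induction x using PreNCTorus.induct with
  | h0 => rw [of_zero, map_zero, map_zero]
  | hadd x y hx hy => rw [of_add, map_add, map_add, hx, hy]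
  | hs g c => rw [← mul_one c, ← PreNCTorus.smul_mono, of_smul, map_smul, map_smul, hg]

end Lift

/-! ### The canonical trace -/

/-- The Hilbert space `ℓ²(ℤ × ℤ)`. -/
abbrev L2 : Type := lp (fun _ : ℤ × ℤ => ℂ) 2

/-- The weighted permutation `(W ξ)(k) = c(k) ξ(σ k)` with unimodular weights `c`. -/
def weighted (σ : Equiv.Perm (ℤ × ℤ)) (c : ℤ × ℤ → Circle) : L2 →ₗᵢ[ℂ] L2 where
  toFun ξ := ⟨fun k => (c k : ℂ) * ξ (σ k), by
    have h := (memℓp_gen_iff (by norm_num : 0 < (2 : ENNReal).toReal)).1 (lp.memℓp ξ)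
    refine memℓp_gen ?_
    simpa [Function.comp_def, Circle.norm_coe] using σ.summable_iff.2 h⟩
  map_add' ξ η := by
    ext k
    exact mul_add _ _ _
  map_smul' a ξ := by
    ext k
    exact mul_left_comm _ _ _
  norm_map' ξ := by
    have h2 : 0 < (2 : ENNReal).toReal := by norm_num
    rw [lp.norm_eq_tsum_rpow h2, lp.norm_eq_tsum_rpow h2]
    congr 1
    refine Eq.trans ?_ (σ.tsum_eq fun k => ‖ξ k‖ ^ (2 : ENNReal).toReal)
    simp [Circle.norm_coe]

theorem weighted_apply (σ : Equiv.Perm (ℤ × ℤ)) (c : ℤ × ℤ → Circle) (ξ : L2) (k : ℤ × ℤ) :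
    weighted σ c ξ k = c k * ξ (σ k) := rfl

theorem weighted_surjective (σ : Equiv.Perm (ℤ × ℤ)) (c : ℤ × ℤ → Circle) :
    Function.Surjective (weighted σ c) := by
  intro ξ
  refine ⟨weighted σ.symm (fun k => (c (σ.symm k))⁻¹) ξ, ?_⟩
  ext k
  simp [weighted_apply]

/-- A weighted permutation as a unitary operator on `ℓ²(ℤ × ℤ)`. -/
def weightedUnitary (σ : Equiv.Perm (ℤ × ℤ)) (c : ℤ × ℤ → Circle) : unitary (L2 →L[ℂ] L2) :=
  Unitary.linearIsometryEquiv.symm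
    (LinearIsometryEquiv.ofSurjective (weighted σ c) (weighted_surjective σ c))

theorem weightedUnitary_apply (σ : Equiv.Perm (ℤ × ℤ)) (c : ℤ × ℤ → Circle) (ξ : L2)
    (k : ℤ × ℤ) : (weightedUnitary σ c : L2 →L[ℂ] L2) ξ k = c k * ξ (σ k) := rfl

/-- The shift `e_{mn} ↦ e_{m+1,n}`. -/
def regU : unitary (L2 →L[ℂ] L2) := weightedUnitary (Equiv.subRight (1, 0)) 1

variable (α) in
/-- The weighted shift `e_{mn} ↦ e^{-2πiαm} e_{m,n+1}`. -/
def regV : unitary (L2 →L[ℂ] L2) :=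
  weightedUnitary (Equiv.subRight (0, 1)) fun k => Circle.exp (-(2 * Real.pi * α * k.1))

theorem rel_regU_regV : Rel α (regU : L2 →L[ℂ] L2) (regV α) := by
  unfold Rel
  ext ξ k
  change (regU : L2 →L[ℂ] L2) ((regV α : L2 →L[ℂ] L2) ξ) k =
    Complex.exp _ * (regV α : L2 →L[ℂ] L2) ((regU : L2 →L[ℂ] L2) ξ) k
  have hk : k - (1, 0) - (0, 1) = k - (0, 1) - (1, 0) := sub_right_comm _ _ _
  simp only [regU, regV, weightedUnitary_apply, Equiv.subRight_apply, Pi.one_apply, hk,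
    Circle.coe_one, one_mul, Circle.coe_exp, ← mul_assoc, ← Complex.exp_add]
  congr 2
  simp
  ring

variable (α) in
/-- The regular representation of `𝔸_α` on `ℓ²(ℤ × ℤ)`, with `e_{mn} = U^m V^n e_{00}`. -/
def reg : NCTorus α →⋆ₐ[ℂ] (L2 →L[ℂ] L2) := lift regU (regV α) rel_regU_regV

variable (α) in
/-- The canonical trace `τ(a) = ⟪e₀₀, a e₀₀⟫`, so that `τ(U^m V^n) = δ_{m,0} δ_{n,0}`. -/
def trace : StrongDual ℂ (NCTorus α) :=
  LinearMap.mkContinuous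
    { toFun := fun a => inner ℂ (lp.single 2 (0, 0) 1 : L2) (reg α a (lp.single 2 (0, 0) 1))
      map_add' := fun a b => by simp
      map_smul' := fun c a => by simp } 1 <| fun a => by
    have he : ‖(lp.single 2 (0, 0) 1 : L2)‖ = 1 := by
      rw [lp.norm_single (by norm_num)]
      simp
    calc ‖inner ℂ (lp.single 2 (0, 0) 1 : L2) (reg α a (lp.single 2 (0, 0) 1))‖
        ≤ ‖(lp.single 2 (0, 0) 1 : L2)‖ * ‖reg α a (lp.single 2 (0, 0) 1)‖ :=
          norm_inner_le_norm _ _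
      _ ≤ ‖(lp.single 2 (0, 0) 1 : L2)‖ * (‖reg α a‖ * ‖(lp.single 2 (0, 0) 1 : L2)‖) := by
          gcongr
          exact (reg α a).le_opNorm _
      _ ≤ 1 * ‖a‖ := by
          rw [he, mul_one, one_mul, one_mul]
          exact NonUnitalStarAlgHom.norm_apply_le (reg α) a

theorem regU_zpow (m : ℤ) (ξ : L2) (k : ℤ × ℤ) :
    ((regU ^ m : unitary (L2 →L[ℂ] L2)) : L2 →L[ℂ] L2) ξ k = ξ (k.1 - m, k.2) := by
  have h1 : ∀ (ξ : L2) (k : ℤ × ℤ), (regU : L2 →L[ℂ] L2) ξ k = ξ (k.1 - 1, k.2) := by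
    intro ξ k
    have : (k.1 - 1, k.2) = k - ((1 : ℤ), (0 : ℤ)) := by ext <;> simp
    rw [this]
    exact one_mul _
  have hm : ∀ (m : ℤ) (ξ : L2) (k : ℤ × ℤ), ((regU ^ (m + 1) : unitary (L2 →L[ℂ] L2)) : L2 →L[ℂ] L2) ξ k =
      ((regU ^ m : unitary (L2 →L[ℂ] L2)) : L2 →L[ℂ] L2) ξ (k.1 - 1, k.2) := by
    intro m ξ k
    rw [add_comm, zpow_add, zpow_one]
    exact h1 _ k
  induction m using Int.induction_on generalizing k with
  | zero => simp
  | succ i ih => rw [hm, ih, sub_sub, add_comm (1 : ℤ)]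
  | pred i ih =>
    have := hm (-i - 1) ξ (k.1 + 1, k.2)
    simp only [sub_add_cancel, add_sub_cancel_right] at this
    rw [← this, ih, show k.1 + 1 - -(i : ℤ) = k.1 - (-i - 1) by ring]

theorem regV_zpow (n : ℤ) (ξ : L2) :
   ∀ k : ℤ × ℤ, ∃ c : Circle,
    ((regV α ^ n : unitary (L2 →L[ℂ] L2)) : L2 →L[ℂ] L2) ξ k = c * ξ (k.1, k.2 - n) := by
  have hm : ∀ (m : ℤ) (k : ℤ × ℤ), ∃ c : Circle, ((regV α ^ (m + 1) : unitary (L2 →L[ℂ] L2)) : L2 →L[ℂ] L2) ξ k =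
      c * ((regV α ^ m : unitary (L2 →L[ℂ] L2)) : L2 →L[ℂ] L2) ξ (k.1, k.2 - 1) := by
    intro m k
    refine ⟨Circle.exp (-(2 * Real.pi * α * k.1)), ?_⟩
    rw [add_comm, zpow_add, zpow_one]
    have : (k.1, k.2 - 1) = k - ((0 : ℤ), (1 : ℤ)) := by ext <;> simp
    rw [this]
    rfl
  induction n using Int.induction_on with
  | zero => intro k; exact ⟨1, by simp⟩
  | succ i ih =>
    intro k
    obtain ⟨c, hc⟩ := hm i k
    obtain ⟨d, hd⟩ := ih (k.1, k.2 - 1)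
    refine ⟨c * d, ?_⟩
    rw [hc, hd, Circle.coe_mul, mul_assoc, sub_sub, add_comm (1 : ℤ)]
  | pred i ih =>
    intro k
    obtain ⟨c, hc⟩ := hm (-i-1) (k.1, k.2 + 1)
    obtain ⟨d, hd⟩ := ih (k.1, k.2 + 1)
    simp only [sub_add_cancel, add_sub_cancel_right] at hc
    refine ⟨c⁻¹ * d, ?_⟩
    rw [hc] at hd
    rw [Circle.coe_mul, mul_assoc, show k.2 - (-(i:ℤ) - 1) = k.2 + 1 - -i by ring, ← hd, ← mul_assoc, ← Circle.coe_mul]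
    simp

/-- The formula `τ(U^m V^n) = δ_{m,0} δ_{n,0}` for the canonical trace. -/
theorem trace_monomial (m n : ℤ) :
    trace α ((U α ^ m * V α ^ n : unitary (NCTorus α)) : NCTorus α) =
      if m = 0 ∧ n = 0 then 1 else 0 := by
  have key : reg α ((U α ^ m * V α ^ n : unitary (NCTorus α)) : NCTorus α) =
      ((regU ^ m * regV α ^ n : unitary (L2 →L[ℂ] L2)) : L2 →L[ℂ] L2) := by
    let r : unitary (NCTorus α) →* unitary (L2 →L[ℂ] L2) :=
      { toFun := fun u => ⟨reg α u, Unitary.map_mem (reg α) u.2⟩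
        map_one' := Subtype.ext (map_one (reg α))
        map_mul' := fun u v => Subtype.ext (map_mul (reg α) _ _) }
    have hu : r (U α) = regU := Subtype.ext (lift_U _ _ _)
    have hv : r (V α) = regV α := Subtype.ext (lift_V _ _ _)
    have h : r (U α ^ m * V α ^ n) = regU ^ m * regV α ^ n := by
      rw [map_mul, map_zpow, map_zpow, hu, hv]
    exact congrArg Subtype.val h
  change inner ℂ (lp.single 2 (0, 0) 1 : L2) (reg α _ (lp.single 2 (0, 0) 1)) = _
  rw [key, lp.inner_single_left]
  obtain ⟨c, hc⟩ := regV_zpow (α := α) n (lp.single 2 (0, 0) 1) (0 - m, 0)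
  have h2 := regU_zpow m (((regV α ^ n : unitary (L2 →L[ℂ] L2)) : L2 →L[ℂ] L2) (lp.single 2 (0, 0) 1)) (0,0)
  rw [Submonoid.coe_mul]
  change inner ℂ (1:ℂ) ((((regU ^ m : unitary (L2 →L[ℂ] L2)) : L2 →L[ℂ] L2) _ : L2) (0,0)) = _
  refine (congrArg (inner ℂ (1 : ℂ)) (h2.trans hc)).trans ?_
  by_cases h : m = 0 ∧ n = 0
  · obtain ⟨rfl, rfl⟩ := h
    simp at hc ⊢
    exact hc.symm
  · rw [if_neg h, lp.single_apply_ne]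
    · simp
    · simpa [Prod.ext_iff] using h

/-! ### The Anzai skew-product -/

/-- A continuous map `f : 𝕋 → 𝕋` as a function on `ℂ` (the values off the circle play no role). -/
def circleFun (f : C(Circle, Circle)) : ℂ → ℂ :=
  Function.extend ((↑) : Circle → ℂ) (fun z => (f z : ℂ)) 0

theorem circleFun_coe (f : C(Circle, Circle)) (z : Circle) : circleFun f z = f z :=
  Circle.coe_injective.extend_apply _ _ _

theorem continuousOn_circleFun (f : C(Circle, Circle)) :
    ContinuousOn (circleFun f) (Submonoid.unitSphere ℂ : Set ℂ) := by
  rw [continuousOn_iff_continuous_domRestrict]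
  have h : (Submonoid.unitSphere ℂ : Set ℂ).domRestrict (circleFun f) =
      fun z : Circle => (f z : ℂ) := funext fun z => circleFun_coe f z
  rw [h]
  exact continuous_subtype_val.comp f.continuous

variable (α) in
theorem spectrum_U_subset : spectrum ℂ (U α : NCTorus α) ⊆ (Submonoid.unitSphere ℂ : Set ℂ) :=
  spectrum.subset_circle_of_unitary (U α).2

/-- `f(U)`, in the sense of the continuous functional calculus. -/
def evalU (f : C(Circle, Circle)) : unitary (NCTorus α) :=
  ⟨cfc (circleFun f) (U α : NCTorus α), by
    rw [cfc_unitary_iff _ _ (isStarNormal_of_mem_unitary (U α).2)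
      ((continuousOn_circleFun f).mono (spectrum_U_subset α))]
    intro z hz
    have h := circleFun_coe f ⟨z, spectrum_U_subset α hz⟩
    change circleFun f z = _ at h
    rw [h, Complex.star_def, ← Circle.coe_inv_eq_conj, ← Circle.coe_mul, inv_mul_cancel,
      Circle.coe_one]⟩

/-- `e^{iθ} U`. -/
def rotU (θ : ℝ) : unitary (NCTorus α) :=
  ⟨(Circle.exp θ : ℂ) • (U α : NCTorus α), by
    have h : star (Circle.exp θ : ℂ) * Circle.exp θ = 1 := by
      rw [Complex.star_def, ← Circle.coe_inv_eq_conj, ← Circle.coe_mul, inv_mul_cancel,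
        Circle.coe_one]
    constructor
    · rw [star_smul, smul_mul_smul_comm, h, one_smul, Unitary.coe_star_mul_self]
    · rw [star_smul, smul_mul_smul_comm, mul_comm, h, one_smul]
      exact Unitary.coe_mul_star_self (U α)⟩

theorem rel_anzai (θ : ℝ) (f : C(Circle, Circle)) :
    Rel α ((rotU θ : unitary (NCTorus α)) : NCTorus α) (evalU f * V α : unitary (NCTorus α)) := by
  have hc : Commute (U α : NCTorus α) ((evalU f : unitary (NCTorus α)) : NCTorus α) := by
    refine (Commute.cfc (Commute.refl _) ?_ _).symm
    exact (Unitary.coe_star_mul_self (U α)).trans (Unitary.coe_mul_star_self (U α)).symm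
  have hr := rel_U_V α
  unfold Rel at hr ⊢
  simp only [rotU, Submonoid.coe_mul, smul_mul_assoc, mul_smul_comm]
  rw [← mul_assoc, hc.eq, mul_assoc, hr, mul_smul_comm, smul_comm, ← mul_assoc]

/-- The Anzai skew-product `Φ_{θ,f}`, determined by `U ↦ e^{iθ} U` and `V ↦ f(U) V`. -/
def anzai (θ : ℝ) (f : C(Circle, Circle)) : NCTorus α →⋆ₐ[ℂ] NCTorus α :=
  lift (rotU θ) (evalU f * V α) (rel_anzai θ f)

theorem anzai_U (θ : ℝ) (f : C(Circle, Circle)) :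
    anzai θ f (U α : NCTorus α) = (Circle.exp θ : ℂ) • (U α : NCTorus α) :=
  lift_U _ _ (rel_anzai θ f)

theorem anzai_V (θ : ℝ) (f : C(Circle, Circle)) :
    anzai θ f (V α : NCTorus α) =
      cfc (circleFun f) (U α : NCTorus α) * (V α : NCTorus α) :=
  lift_V _ _ (rel_anzai θ f)

end NCTorus

/-! ### Ergodicity and minimality -/

section Dynamics

variable {A : Type*} [CStarAlgebra A]

/-- The states of `A`: the positive linear functionals with `φ(1) = 1`. -/
def IsState (φ : StrongDual ℂ A) : Prop := (∀ a, 0 ≤ φ (star a * a)) ∧ φ 1 = 1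

/-- The convex set of states which are invariant under `Φ`. -/
def invariantStates (Φ : A →⋆ₐ[ℂ] A) : Set (StrongDual ℂ A) :=
  {φ | IsState φ ∧ ∀ a, φ (Φ a) = φ a}

/-- `(A, Φ, φ)` is ergodic: `φ` is an extreme point of the set of invariant states. -/
def IsErgodicState (Φ : A →⋆ₐ[ℂ] A) (φ : StrongDual ℂ A) : Prop :=
  φ ∈ Set.extremePoints ℝ (invariantStates Φ)

/-- A hereditary C⋆-subalgebra: a norm-closed `*`-subalgebra `B` (not necessarily containing the
unit) such that `0 ≤ a ≤ b` and `b ∈ B` imply `a ∈ B`. -/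
def IsHereditary [PartialOrder A] (B : NonUnitalStarSubalgebra ℂ A) : Prop :=
  IsClosed (B : Set A) ∧ ∀ a b : A, 0 ≤ a → a ≤ b → b ∈ B → a ∈ B

/-- `(A, Φ)` is minimal: `A` itself is the unique nontrivial (nonzero) hereditary C⋆-subalgebra
`B` of `A` with `Φ(B) ⊆ B`. -/
def IsMinimalSystem [PartialOrder A] (Φ : A →⋆ₐ[ℂ] A) : Prop :=
  ∀ B : NonUnitalStarSubalgebra ℂ A,
    (IsHereditary B ∧ (∀ b ∈ B, Φ b ∈ B) ∧ B ≠ ⊥) ↔ B = ⊤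

end Dynamics

end

/-!
A proper hereditary subalgebra `B` contains no invertible element, so `1` has distance at least `1`
from `B`. If `Φ` preserves `B`, the Birkhoff averages of `Φ` show that `1` even has distance at
least `1` from `B + {Φ a - a}`, and the Hahn–Banach theorem provides an invariant state that
vanishes on `B`. Hence a system all of whose invariant states are faithful is minimal.

For the Anzai system the trace turns out to be the only invariant state. The rotations of `V`
commute with `Φ`, and averaging an invariant state `φ` over them gives the trace: the average
vanishes at `U^m V^n` with `n ≠ 0`, and irrationality gives `φ (U^m) = 0` for `m ≠ 0`. As the trace
is extreme, the rotates of `φ` over which one averages all coincide, and so `φ` is the trace.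
Finally, the trace is faithful because it is the average of any state over all rotations of `U` and
`V`.
-/

noncomputable section

section States

variable {A : Type*} [CStarAlgebra A]

theorem norm_sub_smul_I_sq_le {a : A} (ha : IsSelfAdjoint a) (t : ℝ) :
    ‖a - (t * Complex.I) • (1 : A)‖ ^ 2 ≤ ‖a‖ ^ 2 + t ^ 2 := by
  rcases subsingleton_or_nontrivial A with _ | _
  · simpa [Subsingleton.eq_zero] using sq_nonneg t
  have hsq : star (a - (t * Complex.I) • (1 : A)) * (a - (t * Complex.I) • (1 : A)) =
      a * a + (t ^ 2 : ℂ) • (1 : A) := by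
    have hstar : star (t * Complex.I) = -(t * Complex.I) := by simp
    have hI : (t * Complex.I) * (t * Complex.I) = -(t : ℂ) ^ 2 := by
      linear_combination (t : ℂ) ^ 2 * Complex.I_sq
    simp only [star_sub, ha.star_eq, star_smul, star_one, hstar, sub_mul, mul_sub, mul_smul_comm,
      smul_mul_assoc, mul_one, one_mul, smul_sub, smul_smul, mul_neg, hI]
    module
  calc ‖a - (t * Complex.I) • (1 : A)‖ ^ 2 = ‖a * a + (t ^ 2 : ℂ) • (1 : A)‖ := by
        rw [sq, ← CStarRing.norm_star_mul_self, hsq]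
    _ ≤ ‖a * a‖ + ‖(t ^ 2 : ℂ) • (1 : A)‖ := norm_add_le _ _
    _ ≤ ‖a‖ ^ 2 + t ^ 2 := by
        gcongr
        · exact (norm_mul_le a a).trans_eq (sq _).symm
        · simp [norm_smul]

theorem im_apply_eq_zero_of_norm_le_one {φ : StrongDual ℂ A} (hφ : ‖φ‖ ≤ 1) (h1 : φ 1 = 1)
    {a : A} (ha : IsSelfAdjoint a) : (φ a).im = 0 := by
  have hquad : ∀ t : ℝ, 2 * t * (φ a).im ≤ ‖a‖ ^ 2 := fun t => by
    have him : ((φ a).im + t) ^ 2 ≤ ‖a‖ ^ 2 + t ^ 2 :=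
      calc ((φ a).im + t) ^ 2 = |(φ (a - ((-t : ℝ) * Complex.I) • 1)).im| ^ 2 := by
            simp [h1, sq_abs]
        _ ≤ ‖a - ((-t : ℝ) * Complex.I) • (1 : A)‖ ^ 2 := by
            gcongr
            exact (Complex.abs_im_le_norm _).trans
              ((φ.le_of_opNorm_le hφ _).trans_eq (one_mul _))
        _ ≤ ‖a‖ ^ 2 + t ^ 2 := by simpa using norm_sub_smul_I_sq_le ha (-t)
    nlinarith [sq_nonneg (φ a).im]
  by_contra hne
  have h := hquad ((‖a‖ ^ 2 + 1) / (2 * (φ a).im))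
  rw [show 2 * ((‖a‖ ^ 2 + 1) / (2 * (φ a).im)) * (φ a).im = ‖a‖ ^ 2 + 1 by field_simp] at h
  linarith

theorem isState_of_norm_le_one {φ : StrongDual ℂ A} (hφ : ‖φ‖ ≤ 1) (h1 : φ 1 = 1) :
    IsState φ := by
  let := CStarAlgebra.spectralOrder A
  let := CStarAlgebra.spectralOrderedRing A
  refine ⟨fun x => ?_, h1⟩
  set a := star x * x
  have ha : 0 ≤ a := star_mul_self_nonneg x
  have hsa : IsSelfAdjoint a := .star_mul_self x
  have hnorm : ‖algebraMap ℝ A ‖a‖ - a‖ ≤ ‖a‖ :=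
    (CStarAlgebra.norm_le_iff_le_algebraMap _ (norm_nonneg a)
      (sub_nonneg.2 hsa.le_algebraMap_norm_self)).2 (sub_le_self _ ha)
  have hre : ‖a‖ - (φ a).re ≤ ‖a‖ :=
    calc ‖a‖ - (φ a).re = (φ (algebraMap ℝ A ‖a‖ - a)).re := by
          rw [map_sub, Algebra.algebraMap_eq_smul_one, ← Complex.coe_smul, map_smul, h1]
          simp
      _ ≤ ‖φ (algebraMap ℝ A ‖a‖ - a)‖ := Complex.re_le_norm _
      _ ≤ 1 * ‖a‖ := φ.le_of_opNorm_le_of_le hφ hnorm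
      _ = ‖a‖ := one_mul _
  exact Complex.nonneg_iff.2
    ⟨by linarith, (im_apply_eq_zero_of_norm_le_one hφ h1 hsa).symm⟩

theorem exists_isState_forall_mem_eq_zero (M : Submodule ℂ A) (hM : ∀ x ∈ M, 1 ≤ ‖1 - x‖) :
    ∃ φ : StrongDual ℂ A, IsState φ ∧ ∀ x ∈ M, φ x = 0 := by
  have : Nontrivial A := ⟨1, 0, fun h => by simpa [h] using (hM 0 M.zero_mem).not_gt⟩
  have hdist : ‖(Submodule.Quotient.mk 1 : A ⧸ M)‖ = 1 := by
    refine le_antisymm ((Submodule.Quotient.norm_mk_le M 1).trans norm_one.le) ?_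
    refine le_of_forall_pos_lt_add fun ε hε => ?_
    obtain ⟨m, hm, hlt⟩ := Submodule.Quotient.norm_mk_lt (Submodule.Quotient.mk 1 : A ⧸ M) hε
    simpa using (hM _ ((Submodule.Quotient.eq M).1 hm.symm)).trans_lt (by simpa using hlt)
  obtain ⟨g, hg, hg1⟩ := exists_dual_vector'' ℂ (Submodule.Quotient.mk 1 : A ⧸ M)
  have hbound : ∀ x, ‖(g.toLinearMap.comp M.mkQ) x‖ ≤ 1 * ‖x‖ := fun x =>
    g.le_of_opNorm_le_of_le hg (Submodule.Quotient.norm_mk_le M x)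
  refine ⟨LinearMap.mkContinuous _ 1 hbound,
    isState_of_norm_le_one (LinearMap.mkContinuous_norm_le _ zero_le_one _) ?_, fun x hx => ?_⟩
  · simpa [hdist] using hg1
  · simp [(Submodule.Quotient.mk_eq_zero M).2 hx]

theorem one_le_norm_one_sub_of_not_isUnit {x : A} (hx : ¬IsUnit x) : 1 ≤ ‖1 - x‖ := by
  by_contra! h
  exact hx (by simpa using isUnit_one_sub_of_norm_lt_one h)

theorem eq_zero_of_forall_isState [PartialOrder A] [StarOrderedRing A] {b : A} (hb : 0 ≤ b)
    (h : ∀ φ : StrongDual ℂ A, IsState φ → φ b = 0) : b = 0 := by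
  nontriviality A
  have hspec : ¬IsUnit (algebraMap ℝ A ‖b‖ - b) := CStarAlgebra.norm_mem_spectrum_of_nonneg hb
  obtain ⟨φ, hφ, hφ0⟩ := exists_isState_forall_mem_eq_zero (ℂ ∙ (algebraMap ℝ A ‖b‖ - b))
    fun x hx => one_le_norm_one_sub_of_not_isUnit fun hu => by
      obtain ⟨c, rfl⟩ := Submodule.mem_span_singleton.1 hx
      have hc : c ≠ 0 := fun hc => by simp [hc] at hu
      exact hspec ((isUnit_smul_iff (Units.mk0 c hc) _).1 hu)
  have hnorm := hφ0 _ (Submodule.mem_span_singleton_self _)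
  rw [map_sub, h φ hφ, Algebra.algebraMap_eq_smul_one, ← Complex.coe_smul, map_smul, hφ.2] at hnorm
  simpa using hnorm

end States

section MeanErgodic

open Filter Topology

theorem norm_iterate_le {E : Type*} [Norm E] {f : E → E} (hf : ∀ x, ‖f x‖ ≤ ‖x‖) (n : ℕ) (x : E) :
    ‖f^[n] x‖ ≤ ‖x‖ := by
  induction n with
  | zero => rfl
  | succ n ih => rw [Function.iterate_succ_apply']; exact (hf _).trans ih

section Algebraic

variable {K M : Type*} [DivisionRing K] [AddCommGroup M] [Module K M]

theorem birkhoffAverage_id_sub (f : M →ₗ[K] M) (N : ℕ) (x y : M) :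
    birkhoffAverage K f id N (x - y) = birkhoffAverage K f id N x - birkhoffAverage K f id N y := by
  have hiter : ∀ n, f^[n] (x - y) = f^[n] x - f^[n] y := fun n =>
    iterate_map_sub f.toAddMonoidHom n x y
  simp [birkhoffAverage, birkhoffSum, hiter, smul_sub]

theorem birkhoffAverage_id_mem {f : M → M} {S : Submodule K M} (hfS : ∀ x ∈ S, f x ∈ S) (N : ℕ)
    {x : M} (hx : x ∈ S) : birkhoffAverage K f id N x ∈ S :=
  S.smul_mem _ <| S.sum_mem fun n _ => Set.MapsTo.iterate (s := (S : Set M)) hfS n hx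

end Algebraic

variable {𝕜 E : Type*} [RCLike 𝕜] [NormedAddCommGroup E] [NormedSpace 𝕜 E]

theorem norm_birkhoffAverage_id_le {f : E → E} (hf : ∀ x, ‖f x‖ ≤ ‖x‖) (N : ℕ) (x : E) :
    ‖birkhoffAverage 𝕜 f id N x‖ ≤ ‖x‖ :=
  calc ‖birkhoffAverage 𝕜 f id N x‖ ≤ (N : ℝ)⁻¹ * (N * ‖x‖) := by
        rw [birkhoffAverage, norm_smul, norm_inv, RCLike.norm_natCast]
        gcongr
        simpa [birkhoffSum] using
          norm_sum_le_of_le (Finset.range N) fun n _ => norm_iterate_le hf n x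
    _ ≤ ‖x‖ := by
        rw [← mul_assoc]
        exact mul_le_of_le_one_left (norm_nonneg x) inv_mul_le_one

theorem le_norm_sub_of_mem_sup_range_sub_one {f : E →ₗ[𝕜] E} (hf : ∀ x, ‖f x‖ ≤ ‖x‖) {e : E}
    (he : f e = e) {M : Submodule 𝕜 E} (hfM : ∀ x ∈ M, f x ∈ M) {c : ℝ}
    (hM : ∀ x ∈ M, c ≤ ‖e - x‖) {x : E} (hx : x ∈ M ⊔ LinearMap.range (f - 1)) :
    c ≤ ‖e - x‖ := by
  obtain ⟨b, hb, _, ⟨a, rfl⟩, rfl⟩ := Submodule.mem_sup.1 hx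
  set y := e - (b + (f - 1) a)
  -- Averaging fixes `e`, preserves `M` and asymptotically kills `f a - a`.
  let S : ℕ → E → E := birkhoffAverage 𝕜 f id
  have hS_coboundary : Tendsto (fun N => S N (f a) - S N a) atTop (𝓝 0) :=
    tendsto_birkhoffAverage_apply_sub_birkhoffAverage 𝕜 <| isBounded_iff_forall_norm_le.2
      ⟨‖a‖, Set.forall_mem_range.2 fun n => norm_iterate_le hf n a⟩
  have hS_eq : ∀ N ≠ 0, e - S N b = S N y + (S N (f a) - S N a) := fun N hN => by
    have hSe : S N e = e := Function.IsFixedPt.birkhoffAverage_eq 𝕜 he id (by simpa using hN)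
    have hy' : y = e - b - (f a - a) := sub_add_eq_sub_sub _ _ _
    simp only [hy', S, birkhoffAverage_id_sub] at hSe ⊢
    rw [hSe, sub_add_cancel]
  have hlim := (tendsto_const_nhds (x := ‖y‖)).add hS_coboundary.norm
  rw [norm_zero, add_zero] at hlim
  refine ge_of_tendsto hlim ((eventually_ne_atTop 0).mono fun N hN => ?_)
  calc c ≤ ‖e - S N b‖ := hM _ (birkhoffAverage_id_mem hfM N hb)
    _ ≤ ‖S N y‖ + ‖S N (f a) - S N a‖ := by rw [hS_eq N hN]; exact norm_add_le _ _
    _ ≤ ‖y‖ + ‖S N (f a) - S N a‖ := by gcongr; exact norm_birkhoffAverage_id_le hf N y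

end MeanErgodic

section InvariantStates

variable {A : Type*} [CStarAlgebra A]

theorem exists_mem_invariantStates_forall_mem_eq_zero {Φ : A →⋆ₐ[ℂ] A} {M : Submodule ℂ A}
    (hΦM : ∀ x ∈ M, Φ x ∈ M) (hM : ∀ x ∈ M, 1 ≤ ‖1 - x‖) :
    ∃ φ ∈ invariantStates Φ, ∀ x ∈ M, φ x = 0 := by
  let f : A →ₗ[ℂ] A := Φ.toAlgHom.toLinearMap
  obtain ⟨φ, hφ, hφ0⟩ := exists_isState_forall_mem_eq_zero (M ⊔ LinearMap.range (f - 1))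
    fun _ =>
      le_norm_sub_of_mem_sup_range_sub_one (NonUnitalStarAlgHom.norm_apply_le Φ) (map_one Φ) hΦM hM
  refine ⟨φ, ⟨hφ, fun a => ?_⟩, fun x hx => hφ0 x (Submodule.mem_sup_left hx)⟩
  simpa [sub_eq_zero, f] using hφ0 _ (Submodule.mem_sup_right (LinearMap.mem_range_self (f - 1) a))

end InvariantStates

section Minimality

variable {A : Type*} [CStarAlgebra A] [PartialOrder A] [StarOrderedRing A]

theorem IsHereditary.eq_top_of_one_mem {B : NonUnitalStarSubalgebra ℂ A} (hB : IsHereditary B)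
    (h1 : (1 : A) ∈ B) : B = ⊤ := by
  have hnonneg : {a : A | 0 ≤ a} ⊆ B := fun a ha => by
    refine hB.2 a _ ha (IsSelfAdjoint.of_nonneg ha).le_algebraMap_norm_self ?_
    rw [Algebra.algebraMap_eq_smul_one, ← Complex.coe_smul]
    exact B.smul_mem _ h1
  have hspan := (Submodule.span_le (p := B.toNonUnitalSubalgebra.toSubmodule)).2 hnonneg
  rw [CStarAlgebra.span_nonneg] at hspan
  exact eq_top_iff.2 hspan

theorem IsHereditary.eq_top_of_isUnit_mem {B : NonUnitalStarSubalgebra ℂ A} (hB : IsHereditary B)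
    {b : A} (hb : b ∈ B) (hu : IsUnit b) : B = ⊤ := by
  nontriviality A
  obtain ⟨r, hr, hle⟩ := (CFC.exists_pos_algebraMap_le_iff (a := star b * b)
    (IsSelfAdjoint.star_mul_self b)).2 fun x hx =>
      (CStarAlgebra.isStrictlyPositive_iff_eq_star_mul_self.2 ⟨b, hu, rfl⟩).spectrum_pos hx
  rw [Algebra.algebraMap_eq_smul_one] at hle
  have hrB : r • (1 : A) ∈ B :=
    hB.2 _ _ (smul_nonneg hr.le zero_le_one) hle (mul_mem (star_mem hb) hb)
  refine hB.eq_top_of_one_mem ?_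
  simpa [← Complex.coe_smul, smul_smul, hr.ne'] using B.smul_mem ((r⁻¹ : ℝ) : ℂ) hrB

theorem isMinimalSystem_of_faithful_invariantStates [Nontrivial A] {Φ : A →⋆ₐ[ℂ] A}
    (hΦ : ∀ φ ∈ invariantStates Φ, ∀ a, φ (star a * a) = 0 → a = 0) : IsMinimalSystem Φ := by
  intro B
  constructor
  · rintro ⟨hB, hΦB, hne⟩
    by_contra htop
    obtain ⟨φ, hφ, hφ0⟩ := exists_mem_invariantStates_forall_mem_eq_zero
      (M := B.toNonUnitalSubalgebra.toSubmodule) hΦB fun x hx =>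
        one_le_norm_one_sub_of_not_isUnit fun hu => htop (hB.eq_top_of_isUnit_mem hx hu)
    exact hne <| eq_bot_iff.2 fun b hb => NonUnitalStarAlgebra.mem_bot.2 <|
      hΦ φ hφ b (hφ0 _ (show star b * b ∈ B from mul_mem (star_mem hb) hb))
  · rintro rfl
    refine ⟨⟨isClosed_univ, fun _ _ _ _ _ => trivial⟩, fun _ _ => trivial, fun h => ?_⟩
    have h1 : (1 : A) ∈ (⊥ : NonUnitalStarSubalgebra ℂ A) := h ▸ trivial
    exact one_ne_zero (NonUnitalStarAlgebra.mem_bot.1 h1)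

end Minimality

section StrongContinuity

variable {X A B : Type*} [TopologicalSpace X] [CStarAlgebra A] [CStarAlgebra B]

theorem continuous_apply_of_dense_span {ρ : X → A →⋆ₐ[ℂ] B} {s : Set A}
    (hs : Dense (Submodule.span ℂ s : Set A)) (hρ : ∀ a ∈ s, Continuous fun x => ρ x a) (a : A) :
    Continuous fun x => ρ x a := by
  have hspan : ∀ a ∈ Submodule.span ℂ s, Continuous fun x => ρ x a := fun a ha => by
    induction ha using Submodule.span_induction with
    | mem a ha => exact hρ a ha
    | zero => simpa only [map_zero] using continuous_const
    | add a b _ _ ha hb => simp only [map_add]; exact ha.add hb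
    | smul c a _ ha => simp only [map_smul]; exact ha.const_smul c
  have hlip : ∀ x, LipschitzWith 1 (ρ x) := fun x =>
    AddMonoidHomClass.lipschitz_of_bound_nnnorm _ 1 fun a =>
      (NonUnitalStarAlgHom.norm_apply_le (ρ x) a).trans_eq (one_mul _).symm
  exact (continuous_prod_of_dense_continuous_lipschitzWith (fun p : A × X => ρ p.2 p.1) 1 hs hspan
    hlip).comp (.prodMk_right a)

end StrongContinuity

section Average

open MeasureTheory ProbabilityTheory

variable {X A B : Type*} [TopologicalSpace X] [MeasurableSpace X] [OpensMeasurableSpace X]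
  [CStarAlgebra A] [CStarAlgebra B]

theorem integrable_apply (μ : Measure X) [IsFiniteMeasure μ] {ρ : X → A →⋆ₐ[ℂ] B}
    (hρ : ∀ a, Continuous fun x => ρ x a) (φ : StrongDual ℂ B) (a : A) :
    Integrable (fun x => φ (ρ x a)) μ :=
  .of_bound (φ.continuous.comp (hρ a)).aestronglyMeasurable (‖φ‖ * ‖a‖) <| .of_forall fun x =>
    φ.le_of_opNorm_le_of_le le_rfl (NonUnitalStarAlgHom.norm_apply_le (ρ x) a)

/-- The average `a ↦ ∫ φ(ρₓ(a)) dμ(x)` of the functionals `φ ∘ ρₓ`, where `ρₓ` is a family of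
`*`-homomorphisms. The integral is taken pointwise because `x ↦ φ ∘ ρₓ` is in general only
weak-⋆ continuous. -/
def orbitAverage (μ : Measure X) [IsFiniteMeasure μ] {ρ : X → A →⋆ₐ[ℂ] B}
    (hρ : ∀ a, Continuous fun x => ρ x a) (φ : StrongDual ℂ B) : StrongDual ℂ A :=
  LinearMap.mkContinuous
    { toFun := fun a => ∫ x, φ (ρ x a) ∂μ
      map_add' := fun a b => by
        simp only [map_add]
        exact integral_add (integrable_apply μ hρ φ a) (integrable_apply μ hρ φ b)
      map_smul' := fun c a => by
        simp only [map_smul, RingHom.id_apply]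
        exact integral_smul c _ } (‖φ‖ * μ.real Set.univ) fun a => by
    rw [mul_right_comm]
    exact norm_integral_le_of_norm_le_const <| .of_forall fun x =>
      φ.le_of_opNorm_le_of_le le_rfl (NonUnitalStarAlgHom.norm_apply_le (ρ x) a)

theorem orbitAverage_apply (μ : Measure X) [IsFiniteMeasure μ] {ρ : X → A →⋆ₐ[ℂ] B}
    (hρ : ∀ a, Continuous fun x => ρ x a) (φ : StrongDual ℂ B) (a : A) :
    orbitAverage μ hρ φ a = ∫ x, φ (ρ x a) ∂μ := rfl

theorem IsState.apply_map_nonneg {φ : StrongDual ℂ B} (hφ : IsState φ) (Φ : A →⋆ₐ[ℂ] B) (a : A) :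
    0 ≤ φ (Φ (star a * a)) := by
  simpa only [map_mul, map_star] using hφ.1 (Φ a)

theorem IsState.orbitAverage {μ : Measure X} [IsProbabilityMeasure μ] {ρ : X → A →⋆ₐ[ℂ] B}
    (hρ : ∀ a, Continuous fun x => ρ x a) {φ : StrongDual ℂ B} (hφ : IsState φ) :
    IsState (orbitAverage μ hρ φ) := by
  refine ⟨fun a => ?_, by simp [orbitAverage_apply, hφ.2]⟩
  exact integral_nonneg (f := fun x => φ (ρ x (star a * a))) fun x => hφ.apply_map_nonneg (ρ x) a

theorem apply_eq_zero_of_orbitAverage_eq_zero {μ : Measure X} [IsFiniteMeasure μ]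
    [μ.IsOpenPosMeasure] {ρ : X → A →⋆ₐ[ℂ] B} (hρ : ∀ a, Continuous fun x => ρ x a)
    {φ : StrongDual ℂ B} (hφ : IsState φ) {a : A} (ha : orbitAverage μ hρ φ (star a * a) = 0)
    (x : X) :
    φ (ρ x (star a * a)) = 0 := by
  have hnonneg : ∀ x, 0 ≤ φ (ρ x (star a * a)) := fun x => hφ.apply_map_nonneg (ρ x) a
  have hint := integrable_apply μ hρ φ (star a * a)
  have hre : ∫ x, (φ (ρ x (star a * a))).re ∂μ = 0 :=
    (integral_re hint).trans (by rw [← orbitAverage_apply μ hρ, ha]; rfl)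
  have hae := (integral_eq_zero_iff_of_nonneg (fun x => (Complex.nonneg_iff.1 (hnonneg x)).1)
    hint.re).1 hre
  have hcont : Continuous fun x => (φ (ρ x (star a * a))).re :=
    Complex.continuous_re.comp (φ.continuous.comp (hρ _))
  have hzero := (hcont.ae_eq_iff_eq μ continuous_zero).1 hae
  exact Complex.ext (congrFun hzero x) (Complex.nonneg_iff.1 (hnonneg x)).2.symm

theorem measureReal_smul_orbitAverage_cond (μ : Measure X) [IsFiniteMeasure μ] {ρ : X → A →⋆ₐ[ℂ] B}
    (hρ : ∀ a, Continuous fun x => ρ x a) (φ : StrongDual ℂ B) {s : Set X} (hs : μ s ≠ 0) (a : A) :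
    μ.real s • orbitAverage μ[|s] hρ φ a = ∫ x in s, φ (ρ x a) ∂μ := by
  have hs' : μ.real s ≠ 0 := (measureReal_ne_zero_iff (measure_ne_top μ s)).2 hs
  rw [orbitAverage_apply, ProbabilityTheory.cond, integral_smul_measure, ENNReal.toReal_inv,
    ← measureReal_def, smul_inv_smul₀ hs']

theorem orbitAverage_mem_openSegment_cond (μ : Measure X) [IsProbabilityMeasure μ]
    {ρ : X → A →⋆ₐ[ℂ] B} (hρ : ∀ a, Continuous fun x => ρ x a) (φ : StrongDual ℂ B) {s : Set X}
    (hs : MeasurableSet s) (hs0 : μ s ≠ 0) (hs1 : μ sᶜ ≠ 0) :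
    orbitAverage μ hρ φ ∈ openSegment ℝ (orbitAverage μ[|s] hρ φ) (orbitAverage μ[|sᶜ] hρ φ) := by
  refine ⟨μ.real s, μ.real sᶜ, ENNReal.toReal_pos hs0 (measure_ne_top μ s),
    ENNReal.toReal_pos hs1 (measure_ne_top μ sᶜ), probReal_add_probReal_compl hs,
    ContinuousLinearMap.ext fun a => ?_⟩
  rw [add_apply, smul_apply, smul_apply, measureReal_smul_orbitAverage_cond μ hρ φ hs0,
    measureReal_smul_orbitAverage_cond μ hρ φ hs1, orbitAverage_apply,
    integral_add_compl hs (integrable_apply μ hρ φ a)]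

theorem orbitAverage_mem_invariantStates {μ : Measure X} [IsProbabilityMeasure μ]
    {ρ : X → A →⋆ₐ[ℂ] A} (hρ : ∀ a, Continuous fun x => ρ x a) {Φ : A →⋆ₐ[ℂ] A}
    (hcomm : ∀ x a, ρ x (Φ a) = Φ (ρ x a)) {φ : StrongDual ℂ A} (hφ : φ ∈ invariantStates Φ) :
    orbitAverage μ hρ φ ∈ invariantStates Φ :=
  ⟨hφ.1.orbitAverage hρ, fun a => by simp only [orbitAverage_apply, hcomm, hφ.2]⟩

theorem orbitAverage_cond_eq_of_mem_extremePoints {μ : Measure X} [IsProbabilityMeasure μ]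
    {ρ : X → A →⋆ₐ[ℂ] A} (hρ : ∀ a, Continuous fun x => ρ x a) {Φ : A →⋆ₐ[ℂ] A}
    (hcomm : ∀ x a, ρ x (Φ a) = Φ (ρ x a)) {φ : StrongDual ℂ A} (hφ : φ ∈ invariantStates Φ)
    (hext : orbitAverage μ hρ φ ∈ Set.extremePoints ℝ (invariantStates Φ)) {s : Set X}
    (hs : MeasurableSet s) (hs0 : μ s ≠ 0) : orbitAverage μ[|s] hρ φ = orbitAverage μ hρ φ := by
  by_cases hs1 : μ sᶜ = 0
  · have hcond : μ[|s] = μ := by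
      rw [ProbabilityTheory.cond, (prob_compl_eq_zero_iff hs).1 hs1, inv_one, one_smul,
        Measure.restrict_eq_self_of_ae_mem (mem_ae_iff.2 hs1)]
    simp only [hcond]
  · have := cond_isProbabilityMeasure hs0
    have := cond_isProbabilityMeasure hs1
    exact ((mem_extremePoints.1 hext).2 _ (orbitAverage_mem_invariantStates hρ hcomm hφ) _
      (orbitAverage_mem_invariantStates hρ hcomm hφ)
      (orbitAverage_mem_openSegment_cond μ hρ φ hs hs0 hs1)).1

theorem apply_eq_orbitAverage_of_mem_extremePoints {μ : Measure X} [IsProbabilityMeasure μ]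
    [μ.IsOpenPosMeasure] {ρ : X → A →⋆ₐ[ℂ] A} (hρ : ∀ a, Continuous fun x => ρ x a)
    {Φ : A →⋆ₐ[ℂ] A} (hcomm : ∀ x a, ρ x (Φ a) = Φ (ρ x a)) {φ : StrongDual ℂ A}
    (hφ : φ ∈ invariantStates Φ)
    (hext : orbitAverage μ hρ φ ∈ Set.extremePoints ℝ (invariantStates Φ)) (x : X) (a : A) :
    φ (ρ x a) = orbitAverage μ hρ φ a := by
  have hae : (fun x => φ (ρ x a)) =ᵐ[μ] fun _ => orbitAverage μ hρ φ a := by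
    refine (integrable_apply μ hρ φ a).ae_eq_of_forall_setIntegral_eq _ _ (integrable_const _)
      fun s hs _ => ?_
    by_cases hs0 : μ s = 0
    · simp [Measure.restrict_eq_zero.2 hs0]
    · rw [← measureReal_smul_orbitAverage_cond μ hρ φ hs0, setIntegral_const,
        orbitAverage_cond_eq_of_mem_extremePoints hρ hcomm hφ hext hs hs0]
  exact congrFun (((φ.continuous.comp (hρ a)).ae_eq_iff_eq μ continuous_const).1 hae) x

end Average

section Phases

theorem zpow_mul_zpow_of_mul_eq_smul {K G : Type*} [Group K] [Group G] [MulAction K G]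
    [IsScalarTower K G G] [SMulCommClass K G G] {a b : G} {z : K} (h : b * a = z • (a * b))
    (q m : ℤ) : b ^ q * a ^ m = z ^ (q * m) • (a ^ m * b ^ q) := by
  have hb : SemiconjBy b (a ^ m) (z ^ m • a ^ m) := by
    rw [← smul_zpow]
    exact SemiconjBy.zpow_right (h.trans (smul_mul_assoc z a b).symm) m
  have ha : SemiconjBy (a ^ m) (z ^ m • b) b :=
    (mul_smul_comm _ _ _).trans ((smul_mul_assoc _ _ _).symm.trans hb.eq.symm)
  rw [← (ha.zpow_right q).eq, smul_zpow, mul_smul_comm, ← zpow_mul, mul_comm m q]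

section Instances

variable {R A : Type*} [Monoid R] [StarMul R] [Monoid A] [StarMul A] [MulAction R A]
  [StarModule R A] [SMulCommClass R A A] [IsScalarTower R A A]

instance : SMulCommClass (unitary R) (unitary A) (unitary A) :=
  ⟨fun r a b => Subtype.ext (mul_smul_comm (r : R) (a : A) (b : A)).symm⟩

instance : IsScalarTower (unitary R) (unitary A) (unitary A) :=
  ⟨fun r a b => Subtype.ext (smul_mul_assoc (r : R) (a : A) (b : A))⟩

end Instances

/-- The identification of the unit circle with the group of unitary scalars, through which it acts
on the unitary group of a complex `*`-algebra. -/
def circleToUnitary : Circle →* unitary ℂ where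
  toFun z := ⟨z, Unitary.mem_iff.2 (by simp [← Circle.coe_inv_eq_conj])⟩
  map_one' := rfl
  map_mul' _ _ := rfl

theorem coe_circleToUnitary_smul {A : Type*} [Ring A] [StarRing A] [Algebra ℂ A]
    [StarModule ℂ A] (z : Circle) (u : unitary A) :
    ((circleToUnitary z • u : unitary A) : A) = (z : ℂ) • (u : A) := rfl

theorem apply_coe_zpow_of_apply_eq_smul {A B : Type*} [Ring A] [StarRing A] [Algebra ℂ A]
    [Ring B] [StarRing B] [Algebra ℂ B] [StarModule ℂ B] {Φ : A →⋆ₐ[ℂ] B} {u : unitary A}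
    {v : unitary B} {z : Circle} (h : Φ u = (z : ℂ) • (v : B)) (n : ℤ) :
    Φ (u ^ n : unitary A) = ((z ^ n : Circle) : ℂ) • ((v ^ n : unitary B) : B) := by
  let Φ' : unitary A →⋆* unitary B := Unitary.map ⟨Φ, map_star Φ⟩
  have hu : Φ' u = circleToUnitary z • v := Subtype.ext h
  calc Φ (u ^ n : unitary A) = ((Φ' u ^ n : unitary B) : B) :=
        congrArg Subtype.val (map_zpow Φ' u n)
    _ = ((z ^ n : Circle) : ℂ) • ((v ^ n : unitary B) : B) := by
        rw [hu, smul_zpow, ← map_zpow, coe_circleToUnitary_smul]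

end Phases

section Characters

open MeasureTheory AddCircle

theorem circleExp_zpow_ne_one {θ : ℝ} (hθ : Irrational (θ / (2 * Real.pi))) {m : ℤ} (hm : m ≠ 0) :
    Circle.exp θ ^ m ≠ 1 := by
  rw [← Circle.exp_zsmul, Ne, Circle.exp_eq_one]
  rintro ⟨k, hk⟩
  refine (irrational_iff_ne_rational _).1 hθ k m hm ?_
  rw [zsmul_eq_mul] at hk
  rw [div_eq_div_iff Real.two_pi_pos.ne' (Int.cast_ne_zero.2 hm), mul_comm θ, hk]

theorem integral_fourier {T : ℝ} [Fact (0 < T)] (n : ℤ) :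
    ∫ x : AddCircle T, fourier n x ∂haarAddCircle = if n = 0 then 1 else 0 := by
  have h := congrFun (fourierCoeff_fourier (T := T) n) 0
  simpa [fourierCoeff, Pi.single_apply, eq_comm] using h

end Characters

namespace NCTorus

variable {α : ℝ}

section Monomials

variable (α) in
/-- The monomial `U^m V^n`. It is recorded as a unitary, so that monomials can be multiplied in the
unitary group, where integer powers make sense. -/
def monomial (m n : ℤ) : unitary (NCTorus α) := U α ^ m * V α ^ n

theorem monomial_zero_zero : monomial α 0 0 = 1 := by simp [monomial]

theorem monomial_zero_right (m : ℤ) : monomial α m 0 = U α ^ m := by simp [monomial]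

theorem trace_apply_monomial (m n : ℤ) :
    trace α (monomial α m n) = if m = 0 ∧ n = 0 then 1 else 0 := trace_monomial m n

instance : Nontrivial (NCTorus α) :=
  ⟨1, 0, fun h => by simpa [monomial_zero_zero, h] using trace_apply_monomial (α := α) 0 0⟩

theorem V_mul_U :
    V α * U α = circleToUnitary (Circle.exp (-(2 * Real.pi * α))) • (U α * V α) := by
  have hUV : (U α * V α : NCTorus α) =
      Complex.exp (2 * Real.pi * Complex.I * α) • (V α * U α : NCTorus α) := rel_U_V α
  have hphase : ((-(2 * Real.pi * α) : ℝ) : ℂ) * Complex.I + 2 * Real.pi * Complex.I * α = 0 := by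
    push_cast
    ring
  refine Subtype.ext ?_
  rw [coe_circleToUnitary_smul, Submonoid.coe_mul, Submonoid.coe_mul, hUV, smul_smul,
    Circle.coe_exp, ← Complex.exp_add, hphase, Complex.exp_zero, one_smul]

theorem monomial_mul_monomial (p q m n : ℤ) :
    monomial α p q * monomial α m n =
      circleToUnitary (Circle.exp (-(2 * Real.pi * α))) ^ (q * m) • monomial α (p + m) (q + n) :=
  calc monomial α p q * monomial α m n = U α ^ p * (V α ^ q * U α ^ m) * V α ^ n := by
        simp only [monomial, mul_assoc]
    _ = circleToUnitary (Circle.exp (-(2 * Real.pi * α))) ^ (q * m) •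
          monomial α (p + m) (q + n) := by
        rw [zpow_mul_zpow_of_mul_eq_smul V_mul_U, mul_smul_comm, smul_mul_assoc, monomial,
          zpow_add, zpow_add]
        simp only [mul_assoc]

theorem exists_of_mono_eq_smul_monomial (g : FreeGroup (Fin 2)) :
    ∃ (c : unitary ℂ) (m n : ℤ),
      of (PreNCTorus.mono g 1) = ((c • monomial α m n : unitary (NCTorus α)) : NCTorus α) := by
  have hU : of (PreNCTorus.mono (FreeGroup.of 0) 1) = (U α : NCTorus α) := rfl
  have hV : of (PreNCTorus.mono (FreeGroup.of 1) 1) = (V α : NCTorus α) := rfl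
  induction g using FreeGroup.induction_on with
  | C1 => exact ⟨1, 0, 0, by simp [PreNCTorus.mono_one, of_one, monomial]⟩
  | of i =>
    fin_cases i
    · exact ⟨1, 1, 0, by simpa [monomial] using hU⟩
    · exact ⟨1, 0, 1, by simpa [monomial] using hV⟩
  | inv_of i _ =>
    have hstar : of (PreNCTorus.mono (FreeGroup.of i)⁻¹ 1 : PreNCTorus α) =
        star (of (PreNCTorus.mono (FreeGroup.of i) 1)) := by
      rw [star_of, PreNCTorus.star_mono, star_one]
    fin_cases i
    · exact ⟨1, -1, 0, by
        simpa [monomial, ← Unitary.star_eq_inv] using hstar.trans (congrArg star hU)⟩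
    · exact ⟨1, 0, -1, by
        simpa [monomial, ← Unitary.star_eq_inv] using hstar.trans (congrArg star hV)⟩
  | mul g h hg hh =>
    obtain ⟨c, p, q, hg⟩ := hg
    obtain ⟨d, m, n, hh⟩ := hh
    rw [← mul_one (1 : ℂ), ← PreNCTorus.mono_mul, of_mul, hg, hh, ← Submonoid.coe_mul,
      smul_mul_smul_comm, monomial_mul_monomial, smul_smul]
    exact ⟨_, _, _, rfl⟩

theorem dense_span_monomial :
    Dense (Submodule.span ℂ (Set.range fun k : ℤ × ℤ => (monomial α k.1 k.2 : NCTorus α)) :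
      Set (NCTorus α)) := by
  refine denseRange_of.mono ?_
  rintro _ ⟨x, rfl⟩
  induction x using PreNCTorus.induct with
  | h0 => rw [of_zero]; exact Submodule.zero_mem _
  | hadd x y hx hy => rw [of_add]; exact Submodule.add_mem _ hx hy
  | hs g c =>
    obtain ⟨d, m, n, hg⟩ := exists_of_mono_eq_smul_monomial (α := α) g
    rw [← mul_one c, ← PreNCTorus.smul_mono, of_smul, hg]
    exact Submodule.smul_mem _ c <| Submodule.smul_mem _ (d : ℂ) <|
      Submodule.subset_span ⟨(m, n), rfl⟩

theorem functional_ext {φ ψ : StrongDual ℂ (NCTorus α)}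
    (h : ∀ m n, φ (monomial α m n) = ψ (monomial α m n)) : φ = ψ :=
  ContinuousLinearMap.ext_on dense_span_monomial (by rintro _ ⟨k, rfl⟩; exact h _ _)

end Monomials

section Gauge

theorem Rel.smul_smul {B : Type*} [Semiring B] [Algebra ℂ B] {u v : B} (h : Rel α u v) (c d : ℂ) :
    Rel α (c • u) (d • v) := by
  unfold Rel at h ⊢
  rw [smul_mul_smul_comm, h, smul_mul_smul_comm, smul_comm, mul_comm c]

variable (α) in
/-- The gauge action of the torus on `𝔸_α`, given by `U ↦ e^{2πis} U` and `V ↦ e^{2πit} V`. The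
torus is written additively, as `(ℝ / ℤ)²`. -/
def gauge (t : UnitAddCircle × UnitAddCircle) : NCTorus α →⋆ₐ[ℂ] NCTorus α :=
  lift (circleToUnitary t.1.toCircle • U α) (circleToUnitary t.2.toCircle • V α)
    ((rel_U_V α).smul_smul _ _)

theorem gauge_U (t : UnitAddCircle × UnitAddCircle) :
    gauge α t (U α) = (t.1.toCircle : ℂ) • (U α : NCTorus α) := lift_U _ _ _

theorem gauge_V (t : UnitAddCircle × UnitAddCircle) :
    gauge α t (V α) = (t.2.toCircle : ℂ) • (V α : NCTorus α) := lift_V _ _ _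

theorem gauge_monomial (t : UnitAddCircle × UnitAddCircle) (m n : ℤ) :
    gauge α t (monomial α m n) =
      (fourier m t.1 * fourier n t.2) • (monomial α m n : NCTorus α) := by
  rw [monomial, Submonoid.coe_mul, map_mul, apply_coe_zpow_of_apply_eq_smul (gauge_U t),
    apply_coe_zpow_of_apply_eq_smul (gauge_V t), smul_mul_smul_comm, fourier_apply, fourier_apply,
    AddCircle.toCircle_zsmul, AddCircle.toCircle_zsmul]

theorem gauge_zero : gauge α 0 = StarAlgHom.id ℂ (NCTorus α) :=
  hom_ext ((gauge_U 0).trans (by simp)) ((gauge_V 0).trans (by simp))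

theorem continuous_gauge_apply (a : NCTorus α) : Continuous fun t => gauge α t a := by
  refine continuous_apply_of_dense_span dense_span_monomial ?_ a
  rintro _ ⟨k, rfl⟩
  simp only [gauge_monomial]
  fun_prop

theorem gauge_anzai (θ : ℝ) (f : C(Circle, Circle)) (y : UnitAddCircle) (a : NCTorus α) :
    gauge α (0, y) (anzai θ f a) = anzai θ f (gauge α (0, y) a) := by
  have hU : gauge α (0, y) (U α) = U α := (gauge_U _).trans (by simp)
  suffices h : (gauge α (0, y)).comp (anzai θ f) = (anzai θ f).comp (gauge α (0, y)) from
    DFunLike.congr_fun h a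
  refine hom_ext ?_ ?_
  · simp only [StarAlgHom.comp_apply, anzai_U, map_smul, hU]
  · have hn : IsStarNormal (U α : NCTorus α) := isStarNormal_of_mem_unitary (U α).2
    have hcfc : gauge α (0, y) (cfc (circleFun f) (U α : NCTorus α)) =
        cfc (circleFun f) (U α : NCTorus α) := by
      rw [StarAlgHom.map_cfc (gauge α (0, y)) (circleFun f) (U α : NCTorus α)
        ((continuousOn_circleFun f).mono (spectrum_U_subset α)) (map_continuous _) hn
        (by rwa [hU]), hU]
    simp only [StarAlgHom.comp_apply, anzai_V, map_mul, gauge_V, map_smul, hcfc, mul_smul_comm]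

end Gauge

section Averages

open MeasureTheory AddCircle

theorem orbitAverage_gauge_monomial (φ : StrongDual ℂ (NCTorus α)) (m n : ℤ) :
    orbitAverage (haarAddCircle.prod haarAddCircle) continuous_gauge_apply φ (monomial α m n) =
      (if m = 0 ∧ n = 0 then 1 else 0) * φ (monomial α m n) := by
  simp only [orbitAverage_apply, gauge_monomial, map_smul, smul_eq_mul]
  rw [integral_mul_const, integral_prod_mul (fun x => fourier m x) (fun x => fourier n x),
    integral_fourier, integral_fourier]
  simp only [ite_and, ite_mul, one_mul, zero_mul]

theorem orbitAverage_gauge_eq_trace {φ : StrongDual ℂ (NCTorus α)} (hφ : φ 1 = 1) :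
    orbitAverage (haarAddCircle.prod haarAddCircle) continuous_gauge_apply φ = trace α := by
  refine functional_ext fun m n => ?_
  rw [orbitAverage_gauge_monomial, trace_apply_monomial]
  split_ifs with h
  · rw [h.1, h.2, monomial_zero_zero]; simp [hφ]
  · rw [zero_mul]

theorem eq_zero_of_trace_star_mul_self_eq_zero {a : NCTorus α} (ha : trace α (star a * a) = 0) :
    a = 0 := by
  refine (CStarRing.star_mul_self_eq_zero_iff a).1 <|
    eq_zero_of_forall_isState (star_mul_self_nonneg a) fun φ hφ => ?_
  rw [← orbitAverage_gauge_eq_trace hφ.2] at ha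
  simpa [gauge_zero] using apply_eq_zero_of_orbitAverage_eq_zero continuous_gauge_apply hφ ha 0

theorem apply_monomial_zero_eq_zero {θ : ℝ} (hθ : Irrational (θ / (2 * Real.pi)))
    {f : C(Circle, Circle)} {φ : StrongDual ℂ (NCTorus α)} (hφ : ∀ a, φ (anzai θ f a) = φ a)
    {m : ℤ} (hm : m ≠ 0) : φ (monomial α m 0) = 0 := by
  have hinv := hφ (monomial α m 0)
  rw [monomial_zero_right, apply_coe_zpow_of_apply_eq_smul (anzai_U θ f), map_smul, smul_eq_mul,
    mul_left_eq_self₀] at hinv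
  rw [monomial_zero_right]
  exact hinv.resolve_left fun h => circleExp_zpow_ne_one hθ hm (Circle.coe_eq_one.1 h)

theorem continuous_gauge_zero_apply (a : NCTorus α) : Continuous fun y => gauge α (0, y) a :=
  (continuous_gauge_apply a).comp (.prodMk_right 0)

theorem orbitAverage_gauge_zero_eq_trace {θ : ℝ} (hθ : Irrational (θ / (2 * Real.pi)))
    {f : C(Circle, Circle)} {φ : StrongDual ℂ (NCTorus α)}
    (hφ : φ ∈ invariantStates (anzai θ f)) :
    orbitAverage haarAddCircle continuous_gauge_zero_apply φ = trace α := by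
  refine functional_ext fun m n => ?_
  simp only [orbitAverage_apply, gauge_monomial, map_smul, smul_eq_mul]
  rw [integral_mul_const, integral_const_mul, integral_fourier, trace_apply_monomial]
  rcases eq_or_ne n 0 with rfl | hn
  · rcases eq_or_ne m 0 with rfl | hm
    · simp [monomial_zero_zero, hφ.1.2]
    · simp [hm, apply_monomial_zero_eq_zero hθ hφ.2 hm]
  · simp [hn]

theorem eq_trace_of_mem_invariantStates {θ : ℝ} (hθ : Irrational (θ / (2 * Real.pi)))
    {f : C(Circle, Circle)} (herg : IsErgodicState (anzai θ f) (trace α))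
    {φ : StrongDual ℂ (NCTorus α)} (hφ : φ ∈ invariantStates (anzai θ f)) : φ = trace α := by
  have havg := orbitAverage_gauge_zero_eq_trace hθ hφ
  refine ContinuousLinearMap.ext fun a => ?_
  calc φ a = φ (gauge α (0, 0) a) := by rw [← Prod.zero_eq_mk, gauge_zero]; rfl
    _ = orbitAverage haarAddCircle continuous_gauge_zero_apply φ a :=
        apply_eq_orbitAverage_of_mem_extremePoints continuous_gauge_zero_apply
          (gauge_anzai θ f) hφ (havg ▸ herg) 0 a
    _ = trace α a := by rw [havg]

end Averages

end NCTorus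

end

theorem mainTheorem9 (α θ : ℝ) (hθ : Irrational (θ / (2 * Real.pi))) (f : C(Circle, Circle))
    (herg : IsErgodicState (NCTorus.anzai θ f) (NCTorus.trace α)) :
    IsMinimalSystem (NCTorus.anzai (α := α) θ f) :=
  isMinimalSystem_of_faithful_invariantStates fun φ hφ a ha => by
    rw [NCTorus.eq_trace_of_mem_invariantStates hθ herg hφ] at ha
    exact NCTorus.eq_zero_of_trace_star_mul_self_eq_zero ha
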